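/- Consider the stochastic $N$-agent $K$-armed bandit problem ($N,K\ge 1$). An environment is a probability distribution on utility matrices in $[0,1]^{K\times N}$, with mean matrix $u$; the matrices $u_1,u_2,\dots$ are drawn i.i.d. from it, and $u_{t,i,n}$ is the utility of agent $n$ for arm $i$ in round $t$. In round $t$ the learner chooses, depending on the past observations and possibly at random, a distribution $p_t$ in the simplex $\Delta_K$, draws an arm $i_t\sim p_t$ and observes only the utilities $u_{t,i_t,n}$, $n=1,\dots,N$. The Nash social welfare of $\mu\in[0,1]^N$ is $\mathrm{NSW}(\mu)=\prod_{n=1}^N\mu_n^{1/N}$, and the expected regret over $T$ rounds is $$\mathrm{Reg}_T=T\cdot\max_{p\in\Delta_K}\mathrm{NSW}(u^\top p)-\mathbb E\Big[\sum_{t=1}^T\mathrm{NSW}(u^\top p_t)\Big].$$ Theorem. There is a universal constant $c>0$ such that for all integers $N,K\ge1$ with $N\ge\ln K$ there is a $T_0=T_0(N,K)$ such that, for every $T\ge T_0$ and every algorithm, there is a stochastic environment in which the expected regret of this algorithm satisfies $$\mathrm{Reg}_T\ \ge\ c\,\frac{(\ln K)^3}{N^3}\,K^{1/N}\,T^{(N-1)/N}.$$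 Moreover, the environment can be chosen with a single hidden arm: for some arm $a$ and some $\varepsilon\in(0,1]$, the mean utility of the first agent is $\varepsilon$ for arm $a$ and $0$ for every other arm, and all other agents have constant utility $1$. -/

import Mathlib

open MeasureTheory ProbabilityTheory
open scoped ENNReal

namespace NashBandit

/-- The Nash social welfare of `N` expected utilities: their geometric mean. -/
noncomputable def nsw {N : ℕ} (μ : Fin N → ℝ) : ℝ :=
  ∏ n, μ n ^ ((1 : ℝ) / N)

/-- The simplex of probability distributions over the `K` arms. -/
abbrev Strategy (K : ℕ) : Type := stdSimplex ℝ (Fin K)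

/-- The record of one round: the distribution chosen by the learner, the sampled arm, and the
observed utilities (one per agent) of that arm. -/
abbrev Round (K N : ℕ) : Type := Strategy K × (Fin K × (Fin N → unitInterval))

/-- A stochastic environment: the utility matrices `u_t ∈ [0,1]^{K × N}` are i.i.d. draws
from `law`; entry `u i n` is the utility of agent `n` for arm `i`. -/
structure StochasticEnvironment (K N : ℕ) where
  law : Measure (Fin K → Fin N → unitInterval)
  isProbabilityMeasure_law : IsProbabilityMeasure law

attribute [instance] StochasticEnvironment.isProbabilityMeasure_law

/-- The mean utility matrix of an environment. -/
noncomputable def StochasticEnvironment.mean {K N : ℕ} (E : StochasticEnvironment K N)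
    (i : Fin K) (n : Fin N) : ℝ :=
  ∫ u, (u i n : ℝ) ∂E.law

/-- A (possibly randomized) bandit algorithm: after `t` completed rounds, the next distribution
over the arms is drawn from a law that depends measurably on the record of these rounds. -/
structure BanditAlgorithm (K N : ℕ) where
  policy : (t : ℕ) → Kernel (Fin t → Round K N) (Strategy K)
  isMarkovKernel_policy : ∀ t, IsMarkovKernel (policy t)

attribute [instance] BanditAlgorithm.isMarkovKernel_policy

/-- The vector `uᵀ p` of expected utilities of the agents under the strategy `p`. -/
noncomputable def expectedUtility {K N : ℕ} (u : Fin K → Fin N → ℝ) (p : Strategy K)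
    (n : Fin N) : ℝ :=
  ∑ i, p.1 i * u i n

/-- Sampling an arm from a strategy. -/
noncomputable def sampleArm (K : ℕ) : Kernel (Strategy K) (Fin K) where
  toFun p := ∑ i, ENNReal.ofReal (p.1 i) • Measure.dirac i
  measurable' := by
    refine Measure.measurable_of_measurable_coe _ fun s hs => ?_
    simp only [Measure.coe_finsetSum, Finset.sum_apply, Measure.smul_apply, smul_eq_mul]
    refine Finset.measurable_sum _ fun i _ => Measurable.mul_const ?_ _
    exact ((measurable_pi_apply i).comp measurable_subtype_coe).ennreal_ofReal

instance (K : ℕ) : IsMarkovKernel (sampleArm K) where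
  isProbabilityMeasure p := by
    constructor
    have h : sampleArm K p = ∑ i, ENNReal.ofReal (p.1 i) • Measure.dirac i := rfl
    simp only [h, Measure.coe_finsetSum, Finset.sum_apply, Measure.smul_apply, smul_eq_mul,
      measure_univ, mul_one]
    rw [← ENNReal.ofReal_sum_of_nonneg fun i _ => p.2.1 i, p.2.2, ENNReal.ofReal_one]

/-- Bandit feedback: only the row of the utility matrix at the played arm is observed. -/
def observe {K N : ℕ} (x : Fin K × (Fin K → Fin N → unitInterval)) :
    Fin K × (Fin N → unitInterval) :=
  (x.1, x.2 x.1)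

theorem measurable_observe {K N : ℕ} : Measurable (observe (K := K) (N := N)) :=
  measurable_fst.prodMk
    (measurable_from_prod_countable_right fun i => measurable_pi_apply i)

/-- Given the learner's strategy, draw the arm from it and, independently, the utility matrix
from the environment; return the arm and the observed utilities. -/
noncomputable def StochasticEnvironment.play {K N : ℕ} (E : StochasticEnvironment K N) :
    Kernel (Strategy K) (Fin K × (Fin N → unitInterval)) :=
  (sampleArm K ×ₖ Kernel.const (Strategy K) E.law).map observe

instance {K N : ℕ} (E : StochasticEnvironment K N) : IsMarkovKernel E.play :=
  Kernel.IsMarkovKernel.map _ measurable_observe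

/-- The law of the next round given the record of the first `t` rounds. -/
noncomputable def nextRound {K N : ℕ} (A : BanditAlgorithm K N) (E : StochasticEnvironment K N)
    (t : ℕ) : Kernel (Fin t → Round K N) (Round K N) :=
  A.policy t ⊗ₖ Kernel.prodMkLeft (Fin t → Round K N) E.play

instance {K N : ℕ} (A : BanditAlgorithm K N) (E : StochasticEnvironment K N) (t : ℕ) :
    IsMarkovKernel (nextRound A E t) := by
  unfold nextRound; infer_instance

/-- Append a round to a record of `t` rounds. -/
def appendRound {K N : ℕ} (t : ℕ) (x : (Fin t → Round K N) × Round K N) :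
    Fin (t + 1) → Round K N :=
  Fin.snoc (α := fun _ => Round K N) x.1 x.2

theorem measurable_appendRound {K N : ℕ} (t : ℕ) :
    Measurable (appendRound (K := K) (N := N) t) := by
  refine measurable_pi_lambda _ fun j => ?_
  refine Fin.lastCases ?_ (fun j => ?_) j
  · simpa only [appendRound, Fin.snoc_last] using measurable_snd
  · simpa only [appendRound, Fin.snoc_castSucc] using
      (measurable_pi_iff.1 measurable_fst j)

/-- The law of the record of the first `t` rounds of the interaction. -/
noncomputable def historyLaw {K N : ℕ} (A : BanditAlgorithm K N)
    (E : StochasticEnvironment K N) : (t : ℕ) → Measure (Fin t → Round K N)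
  | 0 => Measure.dirac (fun j => j.elim0)
  | t + 1 => (historyLaw A E t ⊗ₘ nextRound A E t).map (appendRound t)

instance {K N : ℕ} (A : BanditAlgorithm K N) (E : StochasticEnvironment K N) (t : ℕ) :
    IsProbabilityMeasure (historyLaw A E t) := by
  induction t with
  | zero => unfold historyLaw; infer_instance
  | succ t ih =>
    unfold historyLaw
    exact Measure.isProbabilityMeasure_map (measurable_appendRound t).aemeasurable

/-- The expected regret over `T` rounds with respect to the Nash social welfare:
`T · max_p NSW(uᵀ p) - 𝔼[∑_t NSW(uᵀ p_t)]`, where `u` is the mean utility matrix. -/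
noncomputable def regret {K N : ℕ} (A : BanditAlgorithm K N) (E : StochasticEnvironment K N)
    (T : ℕ) : ℝ :=
  T * (⨆ p : Strategy K, nsw (expectedUtility E.mean p)) -
    ∫ h, ∑ t, nsw (expectedUtility E.mean (h t).1) ∂(historyLaw A E T)

/-- The mean utilities of the instance with a hidden arm `a`: for the first agent (index `0`),
arm `a` has mean `ε` and all other arms have mean `0`; every other agent has constant
utility `1`. -/
def hiddenArmMean {K N : ℕ} (a : Fin K) (ε : ℝ) (i : Fin K) (n : Fin N) : ℝ :=
  if (n : ℕ) = 0 then (if i = a then ε else 0) else 1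

end NashBandit

/-!
The two-point method against the null environment, in which the first agent never gets any
utility. A hidden arm is noticed only if it is played in a round in which its Bernoulli(`ε`)
utility is `1`, so expectations of `[0, B]`-valued statistics of `T` rounds change by at most
`B * ε` times the expected mass the learner puts on that arm in the null environment. Hide the arm
whose mass there is at most `T / K`: by concavity of `x ↦ x ^ (1 / N)` the welfare collected is at
most `ε ^ (1 / N) * T * (K ^ (-1 / N) + ε * T / K)`, against an optimum of `ε ^ (1 / N) * T`.
With `δ = 1 - K ^ (-1 / N)`, the choice `ε = δ * K / (2 * T)` makes the regret at least
`(δ / 2) ^ (1 + 1 / N) * K ^ (1 / N) * T ^ (1 - 1 / N)`, where `δ * K ^ (1 / N) = K ^ (1 / N) - 1`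
and `(δ / 2) ^ (1 / N) ≥ 1 / 4` because `δ ≥ 1 / (2 * N)` for `K ≥ 2`.
-/

namespace NashBandit

section RealInequalities

variable {s : ℝ}

theorem rpow_le_rpow_neg_mul_one_add (hs0 : 0 ≤ s) (hs1 : s ≤ 1) {c y : ℝ} (hc : 0 < c)
    (hy : 0 ≤ y) : y ^ s ≤ c ^ (-s) * (1 + s * (c * y - 1)) := by
  have bernoulli : (c * y) ^ s ≤ 1 + s * (c * y - 1) := by
    simpa using rpow_one_add_le_one_add_mul_self
      (by linarith [mul_nonneg hc.le hy] : -1 ≤ c * y - 1) hs0 hs1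
  calc y ^ s = c ^ (-s) * (c * y) ^ s := by
        rw [Real.mul_rpow hc.le hy, ← mul_assoc, ← Real.rpow_add hc, neg_add_cancel,
          Real.rpow_zero, one_mul]
    _ ≤ c ^ (-s) * (1 + s * (c * y - 1)) := by gcongr

theorem half_le_one_sub_rpow_neg (hs0 : 0 ≤ s) (hs1 : s ≤ 1) {r : ℝ} (hr : 2 ≤ r) :
    s / 2 ≤ 1 - r ^ (-s) := by
  have hanti : r ^ (-s) ≤ 2 ^ (-s) :=
    Real.rpow_le_rpow_of_nonpos two_pos hr (neg_nonpos.2 hs0)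
  have htangent : (2 : ℝ) ^ (-s) ≤ 1 + s * (-1 / 2) := by
    rw [Real.rpow_neg_eq_inv_rpow]
    convert rpow_one_add_le_one_add_mul_self (by norm_num : (-1 : ℝ) ≤ -1 / 2) hs0 hs1 using 2
    norm_num
  linarith

theorem four_mul_le_four_pow {n : ℕ} (hn : 1 ≤ n) : 4 * n ≤ 4 ^ n := by
  obtain ⟨m, rfl⟩ := Nat.exists_eq_add_of_le' hn
  rw [pow_succ']
  gcongr
  exact Nat.lt_pow_self (by norm_num)

theorem quarter_le_rpow_half_one_sub_rpow_neg {n : ℕ} (hn : 1 ≤ n) {r : ℝ} (hr : 2 ≤ r) :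
    1 / 4 ≤ ((1 - r ^ (-((1 : ℝ) / n))) / 2) ^ ((1 : ℝ) / n) := by
  have hn1 : (1 : ℝ) ≤ n := by exact_mod_cast hn
  have hgap : (1 : ℝ) / (4 * n) ≤ (1 - r ^ (-((1 : ℝ) / n))) / 2 := by
    have := half_le_one_sub_rpow_neg (by positivity) (div_le_one_of_le₀ hn1 n.cast_nonneg) hr
    have : (1 : ℝ) / (4 * n) = 1 / n / 2 / 2 := by ring
    linarith
  have hpow : (1 / 4 : ℝ) ^ n ≤ 1 / (4 * n) := by
    rw [one_div_pow]
    gcongr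
    exact_mod_cast four_mul_le_four_pow hn
  rw [one_div (n : ℝ), Real.le_rpow_inv_iff_of_pos (by norm_num)
    ((by positivity : (0 : ℝ) ≤ 1 / (4 * n)).trans (by simpa using hgap)) (by positivity),
    Real.rpow_natCast]
  simpa using hpow.trans hgap

theorem log_pow_three_mul_rpow_le {r n : ℝ} (hr : 1 ≤ r) (hrn : Real.log r ≤ n) :
    Real.log r ^ 3 / n ^ 3 * r ^ (1 / n) ≤ 3 * (r ^ (1 / n) - 1) := by
  have hlog : 0 ≤ Real.log r := Real.log_nonneg hr
  rw [Real.rpow_def_of_pos (by linarith), mul_one_div, ← div_pow]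
  set x := Real.log r / n
  have hx0 : 0 ≤ x := div_nonneg hlog (hlog.trans hrn)
  have hx1 : x ≤ 1 := div_le_one_of_le₀ hrn (hlog.trans hrn)
  have hexp : Real.exp x ≤ 3 := (Real.exp_le_exp.2 hx1).trans Real.exp_one_lt_three.le
  calc x ^ 3 * Real.exp x ≤ x * 3 := by
        gcongr
        exact pow_le_of_le_one hx0 hx1 three_ne_zero
    _ ≤ 3 * (Real.exp x - 1) := by linarith [Real.add_one_le_exp x]

theorem one_sub_rpow_neg_mul_rpow {r : ℝ} (hr : 0 < r) (s : ℝ) :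
    (1 - r ^ (-s)) * r ^ s = r ^ s - 1 := by
  rw [sub_mul, one_mul, ← Real.rpow_add hr, neg_add_cancel, Real.rpow_zero]

end RealInequalities

variable {K N : ℕ}

section Cumulative

/-- The total over a record of a quantity `φ` attached to the strategies chosen by the learner. -/
def cumulative {α : Type*} [AddCommMonoid α] (φ : Strategy K → α) {t : ℕ}
    (h : Fin t → Round K N) : α :=
  ∑ j, φ (h j).1

theorem cumulative_appendRound {α : Type*} [AddCommMonoid α] (φ : Strategy K → α) {t : ℕ}
    (h : Fin t → Round K N) (r : Round K N) :
    cumulative φ (appendRound t (h, r)) = cumulative φ h + φ r.1 := by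
  simp only [cumulative, Fin.sum_univ_castSucc, appendRound, Fin.snoc_castSucc, Fin.snoc_last]

theorem cumulative_const_mul {α : Type*} [NonUnitalNonAssocSemiring α] (c : α)
    (φ : Strategy K → α) {t : ℕ} (h : Fin t → Round K N) :
    cumulative (fun p => c * φ p) h = c * cumulative φ h :=
  (Finset.mul_sum _ _ _).symm

theorem measurable_cumulative {α : Type*} [AddCommMonoid α] [MeasurableSpace α]
    [MeasurableAdd₂ α] {φ : Strategy K → α} (hφ : Measurable φ) (t : ℕ) :
    Measurable fun h : Fin t → Round K N => cumulative φ h :=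
  Finset.measurable_sum _ fun j _ => hφ.comp (measurable_fst.comp (measurable_pi_apply j))

variable {φ : Strategy K → ℝ} {t : ℕ}

theorem cumulative_nonneg (hφ : ∀ p, 0 ≤ φ p) (h : Fin t → Round K N) : 0 ≤ cumulative φ h :=
  Finset.sum_nonneg fun _ _ => hφ _

theorem cumulative_le (hφ : ∀ p, φ p ≤ 1) (h : Fin t → Round K N) : cumulative φ h ≤ t := by
  simpa [cumulative] using
    Finset.sum_le_card_nsmul Finset.univ (fun j => φ (h j).1) 1 fun _ _ => hφ _

theorem integrable_historyLaw {g : (Fin t → Round K N) → ℝ} (hg : Measurable g) {B : ℝ}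
    (hg0 : ∀ h, 0 ≤ g h) (hgB : ∀ h, g h ≤ B) (A : BanditAlgorithm K N)
    (E : StochasticEnvironment K N) : Integrable g (historyLaw A E t) :=
  .of_bound hg.aestronglyMeasurable B
    (.of_forall fun h => by rw [Real.norm_of_nonneg (hg0 h)]; exact hgB h)

theorem integrable_cumulative (hφ : Measurable φ) (hφ0 : ∀ p, 0 ≤ φ p) (hφ1 : ∀ p, φ p ≤ 1)
    (A : BanditAlgorithm K N) (E : StochasticEnvironment K N) (t : ℕ) :
    Integrable (cumulative φ) (historyLaw A E t) :=
  integrable_historyLaw (measurable_cumulative hφ t) (cumulative_nonneg hφ0) (cumulative_le hφ1)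
    A E

end Cumulative

section Interaction

theorem lintegral_sampleArm (p : Strategy K) (f : Fin K → ℝ≥0∞) :
    ∫⁻ i, f i ∂sampleArm K p = ∑ i, ENNReal.ofReal (p i) * f i := by
  change ∫⁻ i, f i ∂(∑ i, ENNReal.ofReal (p i) • Measure.dirac i) = _
  simp [lintegral_finsetSum_measure]

theorem lintegral_play (E : StochasticEnvironment K N) (p : Strategy K)
    {f : Fin K × (Fin N → unitInterval) → ℝ≥0∞} (hf : Measurable f) :
    ∫⁻ x, f x ∂E.play p = ∑ i, ENNReal.ofReal (p i) * ∫⁻ u, f (i, u i) ∂E.law := by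
  rw [StochasticEnvironment.play, Kernel.lintegral_map _ measurable_observe _ hf,
    Kernel.prod_apply, Kernel.const_apply,
    lintegral_prod (fun x => f (observe x)) (hf.comp measurable_observe).aemeasurable,
    lintegral_sampleArm]
  rfl

variable (A : BanditAlgorithm K N) (E : StochasticEnvironment K N) (t : ℕ)

theorem lintegral_nextRound (h : Fin t → Round K N) {f : Round K N → ℝ≥0∞} (hf : Measurable f) :
    ∫⁻ r, f r ∂nextRound A E t h = ∫⁻ p, ∫⁻ x, f (p, x) ∂E.play p ∂A.policy t h := by
  rw [nextRound, Kernel.lintegral_compProd _ _ _ hf]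
  rfl

theorem lintegral_historyLaw_succ {f : (Fin (t + 1) → Round K N) → ℝ≥0∞} (hf : Measurable f) :
    ∫⁻ h, f h ∂historyLaw A E (t + 1) =
      ∫⁻ h, ∫⁻ r, f (appendRound t (h, r)) ∂nextRound A E t h ∂historyLaw A E t := by
  rw [historyLaw, lintegral_map hf (measurable_appendRound t),
    Measure.lintegral_compProd (f := fun x => f (appendRound t x))
      (hf.comp (measurable_appendRound t))]

theorem lintegral_cumulative_succ {δ : Strategy K → ℝ≥0∞} (hδ : Measurable δ) :
    ∫⁻ h, cumulative δ h ∂historyLaw A E (t + 1) =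
      ∫⁻ h, cumulative δ h ∂historyLaw A E t +
        ∫⁻ h, ∫⁻ p, δ p ∂A.policy t h ∂historyLaw A E t := by
  rw [lintegral_historyLaw_succ A E t (measurable_cumulative hδ (t + 1)),
    ← lintegral_add_left (measurable_cumulative hδ t)]
  refine lintegral_congr fun h => ?_
  simp only [cumulative_appendRound]
  rw [lintegral_add_left measurable_const, lintegral_const, measure_univ, mul_one,
    lintegral_nextRound A E t h (f := fun r => δ r.1) (hδ.comp measurable_fst)]
  simp only [lintegral_const, measure_univ, mul_one]

theorem lintegral_historyLaw_le_add {E E' : StochasticEnvironment K N} {B : ℝ≥0∞}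
    {δ : Strategy K → ℝ≥0∞} (hδ : Measurable δ)
    (hplay : ∀ p (f : Fin K × (Fin N → unitInterval) → ℝ≥0∞), Measurable f → (∀ x, f x ≤ B) →
      ∫⁻ x, f x ∂E.play p ≤ ∫⁻ x, f x ∂E'.play p + δ p)
    {g : (Fin t → Round K N) → ℝ≥0∞} (hg : Measurable g) (hgB : ∀ h, g h ≤ B) :
    ∫⁻ h, g h ∂historyLaw A E t ≤
      ∫⁻ h, g h ∂historyLaw A E' t + ∫⁻ h, cumulative δ h ∂historyLaw A E' t := by
  induction t with
  | zero => exact le_self_add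
  | succ t ih =>
    have hga : Measurable fun x : (Fin t → Round K N) × Round K N => g (appendRound t x) :=
      hg.comp (measurable_appendRound t)
    have hgh (h : Fin t → Round K N) : Measurable fun r => g (appendRound t (h, r)) :=
      hga.comp measurable_prodMk_left
    have hnext (E : StochasticEnvironment K N) :
        Measurable fun h => ∫⁻ r, g (appendRound t (h, r)) ∂nextRound A E t h :=
      hga.lintegral_kernel_prod_right' (κ := nextRound A E t)
    have hround (h : Fin t → Round K N) :
        ∫⁻ r, g (appendRound t (h, r)) ∂nextRound A E t h ≤
          ∫⁻ r, g (appendRound t (h, r)) ∂nextRound A E' t h + ∫⁻ p, δ p ∂A.policy t h := by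
      rw [lintegral_nextRound _ _ _ _ (hgh h), lintegral_nextRound _ _ _ _ (hgh h),
        ← lintegral_add_right _ hδ]
      exact lintegral_mono fun p =>
        hplay p _ ((hgh h).comp measurable_prodMk_left) fun _ => hgB _
    have hbound (h : Fin t → Round K N) :
        ∫⁻ r, g (appendRound t (h, r)) ∂nextRound A E t h ≤ B :=
      (lintegral_mono fun _ => hgB _).trans_eq (by simp)
    rw [lintegral_historyLaw_succ _ _ _ hg, lintegral_historyLaw_succ _ _ _ hg,
      lintegral_cumulative_succ _ _ _ hδ]
    refine (ih (hnext E) hbound).trans ?_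
    rw [add_comm (lintegral _ (cumulative δ)), ← add_assoc, ← lintegral_add_left (hnext E')]
    gcongr
    exact hround _

end Interaction

section ExpectedMass

theorem measurable_strategy_apply (a : Fin K) : Measurable fun p : Strategy K => p a :=
  (measurable_pi_apply a).comp measurable_subtype_coe

/-- The expected number of times that the arm `a` is drawn in the first `t` rounds, written as the
expected total probability that the learner puts on `a`. -/
noncomputable def expectedMass (A : BanditAlgorithm K N) (E : StochasticEnvironment K N)
    (a : Fin K) (t : ℕ) : ℝ :=
  ∫ h, cumulative (fun p => p a) h ∂historyLaw A E t

variable (A : BanditAlgorithm K N) (E : StochasticEnvironment K N)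

theorem integrable_cumulative_apply (a : Fin K) (t : ℕ) :
    Integrable (cumulative fun p => p a) (historyLaw A E t) :=
  integrable_cumulative (measurable_strategy_apply a) (fun p => stdSimplex.zero_le p a)
    (fun p => stdSimplex.le_one p a) A E t

theorem expectedMass_nonneg (a : Fin K) (t : ℕ) : 0 ≤ expectedMass A E a t :=
  integral_nonneg fun h => cumulative_nonneg (fun p => stdSimplex.zero_le p a) h

theorem ofReal_expectedMass (a : Fin K) (t : ℕ) :
    ENNReal.ofReal (expectedMass A E a t) =
      ∫⁻ h, cumulative (fun p => ENNReal.ofReal (p a)) h ∂historyLaw A E t := by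
  rw [expectedMass, ofReal_integral_eq_lintegral_ofReal (integrable_cumulative_apply A E a t)
    (.of_forall fun h => cumulative_nonneg (fun p => stdSimplex.zero_le p a) h)]
  exact lintegral_congr fun h =>
    ENNReal.ofReal_sum_of_nonneg fun j _ => stdSimplex.zero_le (h j).1 a

theorem sum_expectedMass (t : ℕ) : ∑ a, expectedMass A E a t = t := by
  have hsum (h : Fin t → Round K N) : ∑ a, cumulative (fun p => p a) h = t := by
    simp only [cumulative]
    rw [Finset.sum_comm]
    simp
  simp only [expectedMass]
  rw [← integral_finsetSum _ fun a _ => integrable_cumulative_apply A E a t]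
  simp [hsum]

theorem exists_expectedMass_le (hK : 1 ≤ K) (t : ℕ) : ∃ a, expectedMass A E a t ≤ t / K := by
  have : NeZero K := ⟨by lia⟩
  have hsum : ∑ a, expectedMass A E a t ≤ ∑ _a : Fin K, (t : ℝ) / K := by
    simp [sum_expectedMass, field]
  obtain ⟨a, -, ha⟩ := Finset.exists_le_of_sum_le Finset.univ_nonempty hsum
  exact ⟨a, ha⟩

theorem apply_rpow_nonneg (s : ℝ) (a : Fin K) (p : Strategy K) : 0 ≤ p a ^ s :=
  Real.rpow_nonneg (stdSimplex.zero_le p a) s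

theorem apply_rpow_le_one {s : ℝ} (hs0 : 0 ≤ s) (a : Fin K) (p : Strategy K) : p a ^ s ≤ 1 :=
  Real.rpow_le_one (stdSimplex.zero_le p a) (stdSimplex.le_one p a) hs0

theorem integrable_cumulative_rpow {s : ℝ} (hs0 : 0 ≤ s) (a : Fin K) (t : ℕ) :
    Integrable (cumulative fun p => p a ^ s) (historyLaw A E t) :=
  integrable_cumulative ((measurable_strategy_apply a).pow_const s) (apply_rpow_nonneg s a)
    (apply_rpow_le_one hs0 a) A E t

theorem cumulative_rpow_le {s : ℝ} (hs0 : 0 ≤ s) (hs1 : s ≤ 1) {c : ℝ} (hc : 0 < c) (a : Fin K)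
    {t : ℕ} (h : Fin t → Round K N) :
    cumulative (fun p => p a ^ s) h ≤
      c ^ (-s) * (t * (1 - s) + s * c * cumulative (fun p => p a) h) := by
  calc cumulative (fun p => p a ^ s) h
      ≤ ∑ j, c ^ (-s) * (1 + s * (c * (h j).1 a - 1)) :=
        Finset.sum_le_sum fun j _ =>
          rpow_le_rpow_neg_mul_one_add hs0 hs1 hc (stdSimplex.zero_le (h j).1 a)
    _ = c ^ (-s) * (t * (1 - s) + s * c * cumulative (fun p => p a) h) := by
        simp only [cumulative, ← Finset.mul_sum, Finset.sum_add_distrib, Finset.sum_sub_distrib,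
          Finset.sum_const, Finset.card_univ, Fintype.card_fin, nsmul_eq_mul]
        ring

theorem integral_cumulative_rpow_le {s : ℝ} (hs0 : 0 ≤ s) (hs1 : s ≤ 1) {c : ℝ} (hc : 0 < c)
    (a : Fin K) {t : ℕ} (ha : expectedMass A E a t ≤ t / c) :
    ∫ h, cumulative (fun p => p a ^ s) h ∂historyLaw A E t ≤ c ^ (-s) * t := by
  have hlin : Integrable (fun h => s * c * cumulative (fun p => p a) h) (historyLaw A E t) :=
    (integrable_cumulative_apply A E a t).const_mul _
  calc ∫ h, cumulative (fun p => p a ^ s) h ∂historyLaw A E t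
      ≤ ∫ h, c ^ (-s) * (t * (1 - s) + s * c * cumulative (fun p => p a) h)
          ∂historyLaw A E t :=
        integral_mono (integrable_cumulative_rpow A E hs0 a t)
          (((integrable_const _).add hlin).const_mul _) (cumulative_rpow_le hs0 hs1 hc a)
    _ = c ^ (-s) * (t * (1 - s) + s * (c * expectedMass A E a t)) := by
        rw [integral_const_mul, integral_add (integrable_const _) hlin,
          integral_const_mul (s * c), integral_const, probReal_univ, one_smul, mul_assoc s,
          expectedMass]
    _ ≤ c ^ (-s) * (t * (1 - s) + s * t) := by
        gcongr
        rwa [← le_div_iff₀' hc]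
    _ = c ^ (-s) * t := by ring

end ExpectedMass

section HiddenArm

/-- The utility matrix in which the first agent has utility `0` for every arm and all other agents
have utility `1`. -/
def nullUtility (K N : ℕ) (_ : Fin K) (n : Fin N) : unitInterval :=
  if (n : ℕ) = 0 then 0 else 1

/-- The environment in which the first agent never gets any utility: the reference point against
which every hidden-arm environment is compared. -/
noncomputable def nullEnvironment (K N : ℕ) : StochasticEnvironment K N where
  law := Measure.dirac (nullUtility K N)
  isProbabilityMeasure_law := inferInstance

theorem ofReal_one_sub_add_ofReal (ε : unitInterval) :
    ENNReal.ofReal (1 - ε) + ENNReal.ofReal ε = 1 := by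
  rw [← ENNReal.ofReal_add (sub_nonneg.2 ε.2.2) ε.2.1, sub_add_cancel, ENNReal.ofReal_one]

/-- The environment hiding the arm `a`: with probability `ε` the row of `a` in the null utility
matrix is raised to `1`, so that the first agent's utility for `a` is Bernoulli with mean `ε`. -/
noncomputable def hiddenArmEnvironment (N : ℕ) (a : Fin K) (ε : unitInterval) :
    StochasticEnvironment K N where
  law := ENNReal.ofReal (1 - ε) • Measure.dirac (nullUtility K N) +
    ENNReal.ofReal ε • Measure.dirac (Function.update (nullUtility K N) a 1)
  isProbabilityMeasure_law := ⟨by simp [ofReal_one_sub_add_ofReal]⟩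

theorem mean_hiddenArmEnvironment (a : Fin K) (ε : unitInterval) :
    (hiddenArmEnvironment N a ε).mean = hiddenArmMean a ε := by
  funext i n
  have hint (u : Fin K → Fin N → unitInterval) (r : ℝ) :
      Integrable (fun v : Fin K → Fin N → unitInterval => (v i n : ℝ))
        (ENNReal.ofReal r • Measure.dirac u) :=
    (integrable_dirac (by simp)).smul_measure ENNReal.ofReal_ne_top
  rw [StochasticEnvironment.mean, hiddenArmEnvironment,
    integral_add_measure (hint _ _) (hint _ _), integral_smul_measure, integral_smul_measure,
    integral_dirac, integral_dirac, ENNReal.toReal_ofReal (sub_nonneg.2 ε.2.2),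
    ENNReal.toReal_ofReal ε.2.1]
  obtain rfl | hia := eq_or_ne i a
  · by_cases hn : (n : ℕ) = 0 <;> simp [nullUtility, hiddenArmMean, hn]
  · by_cases hn : (n : ℕ) = 0 <;> simp [nullUtility, hiddenArmMean, hn, hia]

theorem lintegral_law_hiddenArmEnvironment (a : Fin K) (ε : unitInterval)
    (f : (Fin K → Fin N → unitInterval) → ℝ≥0∞) :
    ∫⁻ u, f u ∂(hiddenArmEnvironment N a ε).law =
      ENNReal.ofReal (1 - ε) * f (nullUtility K N) +
        ENNReal.ofReal ε * f (Function.update (nullUtility K N) a 1) := by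
  simp [hiddenArmEnvironment, lintegral_add_measure]

theorem lintegral_play_hiddenArm_le (a : Fin K) (ε : unitInterval) (p : Strategy K) {B : ℝ≥0∞}
    {f : Fin K × (Fin N → unitInterval) → ℝ≥0∞} (hf : Measurable f) (hfB : ∀ x, f x ≤ B) :
    ∫⁻ x, f x ∂(hiddenArmEnvironment N a ε).play p ≤
      ∫⁻ x, f x ∂(nullEnvironment K N).play p + B * ENNReal.ofReal ε * ENNReal.ofReal (p a) := by
  have hlaw (i : Fin K) : ∫⁻ u, f (i, u i) ∂(hiddenArmEnvironment N a ε).law ≤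
      f (i, nullUtility K N i) + if i = a then B * ENNReal.ofReal ε else 0 := by
    rw [lintegral_law_hiddenArmEnvironment a ε fun u => f (i, u i)]
    have hε := ofReal_one_sub_add_ofReal ε
    split_ifs with hia
    · rw [mul_comm B]
      gcongr
      · exact mul_le_of_le_one_left' (le_self_add.trans_eq hε)
      · exact hfB _
    · rw [Function.update_of_ne hia, ← add_mul, hε, one_mul, add_zero]
  have hnull (i : Fin K) :
      ∫⁻ u, f (i, u i) ∂(nullEnvironment K N).law = f (i, nullUtility K N i) :=
    lintegral_dirac _ _
  calc ∫⁻ x, f x ∂(hiddenArmEnvironment N a ε).play p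
      ≤ ∑ i, ENNReal.ofReal (p i) *
          (f (i, nullUtility K N i) + if i = a then B * ENNReal.ofReal ε else 0) := by
        rw [lintegral_play _ _ hf]
        gcongr with i
        exact hlaw i
    _ = ∫⁻ x, f x ∂(nullEnvironment K N).play p +
          B * ENNReal.ofReal ε * ENNReal.ofReal (p a) := by
        simp only [lintegral_play _ _ hf, hnull, mul_add, Finset.sum_add_distrib, mul_ite, mul_zero,
          Finset.sum_ite_eq', Finset.mem_univ, if_true]
        rw [mul_comm (ENNReal.ofReal (p a))]

theorem lintegral_historyLaw_hiddenArm_le (A : BanditAlgorithm K N) (a : Fin K)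
    (ε : unitInterval) {t : ℕ} {B : ℝ≥0∞} {g : (Fin t → Round K N) → ℝ≥0∞} (hg : Measurable g)
    (hgB : ∀ h, g h ≤ B) :
    ∫⁻ h, g h ∂historyLaw A (hiddenArmEnvironment N a ε) t ≤
      ∫⁻ h, g h ∂historyLaw A (nullEnvironment K N) t +
        B * ENNReal.ofReal ε * ENNReal.ofReal (expectedMass A (nullEnvironment K N) a t) := by
  have hp : Measurable fun p : Strategy K => ENNReal.ofReal (p a) :=
    (measurable_strategy_apply a).ennreal_ofReal
  refine (lintegral_historyLaw_le_add A t (hp.const_mul _)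
    (fun p _ => lintegral_play_hiddenArm_le a ε p) hg hgB).trans_eq ?_
  simp only [cumulative_const_mul]
  rw [lintegral_const_mul _ (measurable_cumulative hp t), ofReal_expectedMass]

theorem integral_historyLaw_hiddenArm_le (A : BanditAlgorithm K N) (a : Fin K)
    (ε : unitInterval) {t : ℕ} {B : ℝ} {g : (Fin t → Round K N) → ℝ} (hg : Measurable g)
    (hg0 : ∀ h, 0 ≤ g h) (hgB : ∀ h, g h ≤ B) :
    ∫ h, g h ∂historyLaw A (hiddenArmEnvironment N a ε) t ≤
      ∫ h, g h ∂historyLaw A (nullEnvironment K N) t +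
        B * ε * expectedMass A (nullEnvironment K N) a t := by
  have hB : 0 ≤ B := by
    obtain ⟨h⟩ := (historyLaw A (nullEnvironment K N) t).nonempty_of_neZero
    exact (hg0 h).trans (hgB h)
  have hBε : 0 ≤ B * (ε : ℝ) := mul_nonneg hB ε.2.1
  have hmass := expectedMass_nonneg A (nullEnvironment K N) a t
  have hlin (E : StochasticEnvironment K N) : ENNReal.ofReal (∫ h, g h ∂historyLaw A E t) =
      ∫⁻ h, ENNReal.ofReal (g h) ∂historyLaw A E t :=
    ofReal_integral_eq_lintegral_ofReal (integrable_historyLaw hg hg0 hgB A E) (.of_forall hg0)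
  rw [← ENNReal.ofReal_le_ofReal_iff (add_nonneg (integral_nonneg hg0) (by positivity)),
    ENNReal.ofReal_add (integral_nonneg hg0) (by positivity), ENNReal.ofReal_mul hBε,
    ENNReal.ofReal_mul hB, hlin, hlin]
  exact lintegral_historyLaw_hiddenArm_le A a ε hg.ennreal_ofReal
    fun h => ENNReal.ofReal_le_ofReal (hgB h)

end HiddenArm

section Regret

theorem nsw_expectedUtility_hiddenArmMean (hN : 1 ≤ N) (a : Fin K) {ε : ℝ} (hε : 0 ≤ ε)
    (p : Strategy K) :
    nsw (expectedUtility (N := N) (hiddenArmMean a ε) p) =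
      ε ^ ((1 : ℝ) / N) * p a ^ ((1 : ℝ) / N) := by
  obtain ⟨M, rfl⟩ := Nat.exists_eq_add_of_le' hN
  have hfirst : expectedUtility (N := M + 1) (hiddenArmMean a ε) p 0 = ε * p a := by
    rw [mul_comm]
    simp [expectedUtility, hiddenArmMean, DFunLike.coe]
  have hothers (n : Fin M) : expectedUtility (hiddenArmMean a ε) p n.succ = 1 := by
    simp [expectedUtility, hiddenArmMean, p.2.2]
  simp [nsw, Fin.prod_univ_succ, hfirst, hothers,
    Real.mul_rpow hε (stdSimplex.zero_le p a)]

theorem iSup_nsw_hiddenArmMean (hN : 1 ≤ N) (a : Fin K) {ε : ℝ} (hε : 0 ≤ ε) :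
    ⨆ p, nsw (expectedUtility (N := N) (hiddenArmMean a ε) p) = ε ^ ((1 : ℝ) / N) := by
  simp only [nsw_expectedUtility_hiddenArmMean hN a hε]
  refine IsGreatest.csSup_eq ⟨⟨stdSimplex.vertex a, by simp⟩, ?_⟩
  rintro _ ⟨p, rfl⟩
  exact mul_le_of_le_one_right (by positivity) (apply_rpow_le_one (by positivity) a p)

variable (A : BanditAlgorithm K N)

theorem regret_hiddenArmEnvironment (hN : 1 ≤ N) (a : Fin K) (ε : unitInterval) (T : ℕ) :
    regret A (hiddenArmEnvironment N a ε) T = (ε : ℝ) ^ ((1 : ℝ) / N) *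
      (T - ∫ h, cumulative (fun p => p a ^ ((1 : ℝ) / N)) h
        ∂historyLaw A (hiddenArmEnvironment N a ε) T) := by
  rw [regret, mean_hiddenArmEnvironment, iSup_nsw_hiddenArmMean hN a ε.2.1]
  simp only [nsw_expectedUtility_hiddenArmMean hN a ε.2.1, ← Finset.mul_sum, cumulative]
  rw [integral_const_mul, mul_sub, mul_comm (T : ℝ)]

theorem regret_hiddenArmEnvironment_nonneg (hN : 1 ≤ N) (a : Fin K) (ε : unitInterval) (T : ℕ) :
    0 ≤ regret A (hiddenArmEnvironment N a ε) T := by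
  have hs : (0 : ℝ) ≤ 1 / N := by positivity
  rw [regret_hiddenArmEnvironment A hN]
  refine mul_nonneg (Real.rpow_nonneg ε.2.1 _) (sub_nonneg.2 ?_)
  calc ∫ h, cumulative (fun p => p a ^ ((1 : ℝ) / N)) h
        ∂historyLaw A (hiddenArmEnvironment N a ε) T
      ≤ ∫ _, (T : ℝ) ∂historyLaw A (hiddenArmEnvironment N a ε) T :=
        integral_mono (integrable_cumulative_rpow A _ hs a T) (integrable_const _)
          (cumulative_le (apply_rpow_le_one hs a))
    _ = T := by simp

theorem exists_le_regret_hiddenArm (hN : 1 ≤ N) (hK : 1 ≤ K) (ε : unitInterval) (T : ℕ) :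
    ∃ a : Fin K, (ε : ℝ) ^ ((1 : ℝ) / N) *
        (T * (1 - (K : ℝ) ^ (-((1 : ℝ) / N)) - ε * (T / K))) ≤
      regret A (hiddenArmEnvironment N a ε) T := by
  have hs0 : (0 : ℝ) ≤ 1 / N := by positivity
  have hs1 : (1 : ℝ) / N ≤ 1 := div_le_one_of_le₀ (by exact_mod_cast hN) N.cast_nonneg
  have hK0 : (0 : ℝ) < K := by exact_mod_cast hK
  have hε := ε.2.1
  obtain ⟨a, ha⟩ := exists_expectedMass_le A (nullEnvironment K N) hK T
  refine ⟨a, ?_⟩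
  rw [regret_hiddenArmEnvironment A hN]
  gcongr
  have hwelfare :=
    calc ∫ h, cumulative (fun p => p a ^ ((1 : ℝ) / N)) h
          ∂historyLaw A (hiddenArmEnvironment N a ε) T
        ≤ ∫ h, cumulative (fun p => p a ^ ((1 : ℝ) / N)) h ∂historyLaw A (nullEnvironment K N) T +
            T * ε * expectedMass A (nullEnvironment K N) a T :=
          integral_historyLaw_hiddenArm_le A a ε
            (measurable_cumulative ((measurable_strategy_apply a).pow_const _) T)
            (cumulative_nonneg (apply_rpow_nonneg _ a)) (cumulative_le (apply_rpow_le_one hs0 a))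
      _ ≤ (K : ℝ) ^ (-((1 : ℝ) / N)) * T + T * ε * (T / K) := by
          gcongr
          exact integral_cumulative_rpow_le A _ hs0 hs1 hK0 a ha
  linarith

theorem exists_rpow_sub_one_mul_le_regret_hiddenArm (hN : 1 ≤ N) (hK : 2 ≤ K) {T : ℕ} (hT : K ≤ T) :
    ∃ (a : Fin K) (ε : unitInterval), (0 : ℝ) < ε ∧
      1 / 8 * (((K : ℝ) ^ ((1 : ℝ) / N) - 1) * (T : ℝ) ^ (1 - (1 : ℝ) / N)) ≤
        regret A (hiddenArmEnvironment N a ε) T := by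
  have hN0 : (0 : ℝ) < N := by exact_mod_cast hN
  have hK2 : (2 : ℝ) ≤ K := by exact_mod_cast hK
  have hK0 : (0 : ℝ) < K := by linarith
  have hKT : (K : ℝ) ≤ T := by exact_mod_cast hT
  have hT0 : (0 : ℝ) < T := by linarith
  have hroot := quarter_le_rpow_half_one_sub_rpow_neg hN hK2
  have hδK := one_sub_rpow_neg_mul_rpow hK0 (1 / N)
  have hδ0 : 0 < 1 - (K : ℝ) ^ (-((1 : ℝ) / N)) :=
    sub_pos.2 (Real.rpow_lt_one_of_one_lt_of_neg (by linarith) (by simpa using hN0))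
  have hδ1 : 1 - (K : ℝ) ^ (-((1 : ℝ) / N)) ≤ 1 := sub_le_self _ (by positivity)
  set δ : ℝ := 1 - (K : ℝ) ^ (-((1 : ℝ) / N))
  have hε0 : 0 < δ / 2 * (K / T) := by positivity
  have hε1 : δ / 2 * (K / T) ≤ 1 :=
    mul_le_one₀ (by linarith) (by positivity) (div_le_one_of_le₀ hKT hT0.le)
  obtain ⟨a, ha⟩ := exists_le_regret_hiddenArm A hN (by lia) ⟨_, hε0.le, hε1⟩ T
  refine ⟨a, ⟨_, hε0.le, hε1⟩, hε0, le_trans ?_ ha⟩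
  have hcancel : δ / 2 * (K / T) * (T / K) = δ / 2 := by field_simp
  calc 1 / 8 * (((K : ℝ) ^ ((1 : ℝ) / N) - 1) * (T : ℝ) ^ (1 - (1 : ℝ) / N))
      = 1 / 4 * ((K : ℝ) ^ ((1 : ℝ) / N) / (T : ℝ) ^ ((1 : ℝ) / N)) * (T * (δ - δ / 2)) := by
        rw [← hδK, Real.rpow_sub hT0, Real.rpow_one]
        ring
    _ ≤ (δ / 2) ^ ((1 : ℝ) / N) * ((K : ℝ) ^ ((1 : ℝ) / N) / (T : ℝ) ^ ((1 : ℝ) / N)) *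
          (T * (δ - δ / 2)) := by
        have : 0 ≤ δ - δ / 2 := by linarith
        gcongr
    _ = (δ / 2 * (K / T)) ^ ((1 : ℝ) / N) * (T * (δ - δ / 2 * (K / T) * (T / K))) := by
        rw [hcancel, Real.mul_rpow (by positivity) (by positivity), Real.div_rpow hK0.le hT0.le]

end Regret

end NashBandit

open NashBandit

theorem theorem2_general {N K T : ℕ} (hN : 1 ≤ N) (hK : 1 ≤ K) (hT : K ≤ T)
    (A : BanditAlgorithm K N) :
    ∃ E : StochasticEnvironment K N,
      (∃ (a : Fin K) (ε : ℝ), 0 < ε ∧ ε ≤ 1 ∧ E.mean = hiddenArmMean a ε) ∧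
      1 / 8 * (((K : ℝ) ^ ((1 : ℝ) / N) - 1) * (T : ℝ) ^ (((N : ℝ) - 1) / N)) ≤
        regret A E T := by
  have hN0 : (N : ℝ) ≠ 0 := by exact_mod_cast (by lia : N ≠ 0)
  rw [sub_div, div_self hN0]
  obtain rfl | hK2 := hK.eq_or_lt
  · exact ⟨hiddenArmEnvironment N 0 1, ⟨0, 1, one_pos, le_rfl, mean_hiddenArmEnvironment 0 1⟩,
      by simpa using regret_hiddenArmEnvironment_nonneg A hN 0 1 T⟩
  · obtain ⟨a, ε, hε, h⟩ := exists_rpow_sub_one_mul_le_regret_hiddenArm A hN hK2 hT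
    exact ⟨hiddenArmEnvironment N a ε, ⟨a, ε, hε, ε.2.2, mean_hiddenArmEnvironment a ε⟩, h⟩

theorem theorem2 :
    ∃ c : ℝ, 0 < c ∧
      ∀ N K : ℕ, 1 ≤ N → 1 ≤ K → Real.log K ≤ N →
        ∃ T₀ : ℕ, ∀ T : ℕ, T₀ ≤ T →
          ∀ A : NashBandit.BanditAlgorithm K N,
            ∃ E : NashBandit.StochasticEnvironment K N,
              (∃ (a : Fin K) (ε : ℝ), 0 < ε ∧ ε ≤ 1 ∧
                E.mean = NashBandit.hiddenArmMean a ε) ∧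
              c * (Real.log K ^ 3 / (N : ℝ) ^ 3 * (K : ℝ) ^ ((1 : ℝ) / N) *
                  (T : ℝ) ^ (((N : ℝ) - 1) / N)) ≤
                NashBandit.regret A E T := by
  refine ⟨1 / 24, by norm_num, fun N K hN hK hKN => ⟨K, fun T hT A => ?_⟩⟩
  obtain ⟨E, hE, hreg⟩ := theorem2_general hN hK hT A
  have hcube := log_pow_three_mul_rpow_le (by exact_mod_cast hK : (1 : ℝ) ≤ K) hKN
  have hscaled := mul_le_mul_of_nonneg_right hcube
    (Real.rpow_nonneg T.cast_nonneg (((N : ℝ) - 1) / N))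
  exact ⟨E, hE, by linarith⟩
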